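/- For $\sigma>0$ let $L_2^\sigma(0,1)$ be $L_2(0,1)$ with the inner product $\langle x,y\rangle_\sigma=\int_0^1 e^{-2\sigma t}x(t)y(t)\,dt$ and norm $\|\cdot\|_\sigma$; let $\|\cdot\|$ be the norm of $L_2(0,1)$. Let $H_1^\sigma(0,1)$ be the space of absolutely continuous $x$ with $x'\in L_2(0,1)$, with norm $\|x\|_{1,\sigma}=\frac12(\|x\|_\sigma^2+\|x'\|_\sigma^2)^{1/2}$. Let $[F(x)](s)=\int_0^s x(s-t)x(t)\,dt$, $s\in[0,1]$, be the autoconvolution operator, with Fréchet derivative $[F'(x)h](s)=2\int_0^s x(s-t)h(t)\,dt$. **Theorem.** Let $x_0\in W^2_\infty(0,1)$ be positive with $x_0(0)>0$. Let $\sigma>0$ be such that $F'(x_0)$ is accretive on $L_2^\sigma(0,1)$, i.e. $\langle F'(x_0)v,v\rangle_\sigma\ge0$ for all $v$, and such that the solution $\omega\in L_2(0,1)$ of the Volterra equation $F'(x_0)\omega=x_0-x_0(0)$ satisfies $\|\omega\|_\sigma<1/4$. Let $L<\infty$. Then there are constants $c,C>0$, depending only on $x_0$, $\sigma$ and $L$,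 such that the following holds. Let $X_m\subset L_2(0,1)$, $m=1,2,\dots$, be subspaces with $\dim X_m=m$ and $\inf_{z\in X_m}\|x-z\|_\sigma\le\frac Lm\|x\|_{1,\sigma}$ for all $x\in H_1^\sigma(0,1)$ and all $m$, and let $Q_m$ be the projection onto $X_m$ that is orthogonal in $L_2^\sigma(0,1)$. Let $0<\delta\le1$, let $m\ge\sigma/\delta$, and let the data $y^\delta$ satisfy $\|y^\delta-F(x_0)\|_\infty\le\delta$. Let $a$ be the mean of $y^\delta$ over that interval of the partition of $[0,1]$ into $m$ intervals $[(i-1)/m,i/m)$ (the last one closed) which contains $\sqrt\delta$, and let $x_*$ be the constant function with value $\sqrt{a/\sqrt\delta}$ if $a\ge0$, and $0$ otherwise. Then, for $\alpha:=c\sqrt\delta$, the equation $$\alpha Q_m(x_*-x)+Q_my^\delta=Q_mF(Q_mx)$$ has a solution $x=x_\alpha^\delta\in X_m$ with $$\|x_0-x_\alpha^\delta\|_\sigma\le c\sqrt\delta\qquad\text{and}\qquad\|x_0-x_\alpha^\delta\|\le C\sqrt\delta .$$ -/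

import Mathlib

open MeasureTheory Set

noncomputable section

namespace Autoconv

/-- The measure `e^{-2σt} dt` on the interval `(0,1)`. -/
def weightedMeasure (σ : ℝ) : Measure ℝ :=
  (volume.restrict (Ioo (0 : ℝ) 1)).withDensity
    (fun t => ENNReal.ofReal (Real.exp (-2 * σ * t)))

/-- The weighted Hilbert space `L₂^σ(0,1)`, with inner product `∫₀¹ e^{-2σt} x(t) y(t) dt`. -/
abbrev L2w (σ : ℝ) : Type := Lp ℝ 2 (weightedMeasure σ)

theorem restrict_le_smul_weightedMeasure (σ : ℝ) :
    volume.restrict (Ioo (0 : ℝ) 1) ≤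
      ENNReal.ofReal (Real.exp (2 * |σ|)) • weightedMeasure σ := by
  have hm : Measurable (fun t : ℝ => ENNReal.ofReal (Real.exp (-2 * σ * t))) := by fun_prop
  rw [weightedMeasure, ← withDensity_smul _ hm]
  conv_lhs => rw [← withDensity_one (μ := volume.restrict (Ioo (0 : ℝ) 1))]
  refine withDensity_mono ?_
  refine (ae_restrict_iff' measurableSet_Ioo).2 (Filter.Eventually.of_forall fun t ht => ?_)
  simp only [Pi.one_apply, Pi.smul_apply, smul_eq_mul]
  rw [← ENNReal.ofReal_mul (Real.exp_nonneg _), ← Real.exp_add, ← ENNReal.ofReal_one]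
  refine ENNReal.ofReal_le_ofReal (Real.one_le_exp ?_)
  have h1 : σ * t ≤ |σ| * t := mul_le_mul_of_nonneg_right (le_abs_self σ) ht.1.le
  have h2 : |σ| * t ≤ |σ| * 1 := mul_le_mul_of_nonneg_left ht.2.le (abs_nonneg σ)
  linarith

instance isFiniteMeasure_weightedMeasure (σ : ℝ) : IsFiniteMeasure (weightedMeasure σ) := by
  refine isFiniteMeasure_withDensity_ofReal ?_
  refine (HasFiniteIntegral.of_bounded (C := Real.exp (2 * |σ|)) ?_)
  refine (ae_restrict_iff' measurableSet_Ioo).2 (Filter.Eventually.of_forall fun t ht => ?_)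
  rw [Real.norm_eq_abs, abs_of_pos (Real.exp_pos _)]
  refine Real.exp_le_exp.2 ?_
  have h1 : -σ * t ≤ |σ| * t := mul_le_mul_of_nonneg_right (neg_le_abs σ) ht.1.le
  have h2 : |σ| * t ≤ |σ| * 1 := mul_le_mul_of_nonneg_left ht.2.le (abs_nonneg σ)
  linarith

/-- The convolution `s ↦ ∫₀ˢ u(s-t) v(t) dt`. -/
def conv (u v : ℝ → ℝ) (s : ℝ) : ℝ := ∫ t in (0 : ℝ)..s, u (s - t) * v t

theorem memLp_restrict {σ : ℝ} (u : L2w σ) :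
    MemLp u 2 (volume.restrict (Ioo (0 : ℝ) 1)) :=
  (Lp.memLp u).of_measure_le_smul ENNReal.ofReal_ne_top (restrict_le_smul_weightedMeasure σ)

theorem abs_conv_le {u v : ℝ → ℝ} (hu : MemLp u 2 (volume.restrict (Ioo (0 : ℝ) 1)))
    (hv : MemLp v 2 (volume.restrict (Ioo (0 : ℝ) 1))) {s : ℝ} (hs : s ∈ Ioo (0 : ℝ) 1) :
    |conv u v s| ≤ (∫ t in Ioo (0 : ℝ) 1, u t ^ 2) + ∫ t in Ioo (0 : ℝ) 1, v t ^ 2 := by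
  have hu2 : IntegrableOn (fun t => u t ^ 2) (Ioo (0 : ℝ) 1) := hu.integrable_sq
  have hv2 : IntegrableOn (fun t => v t ^ 2) (Ioo (0 : ℝ) 1) := hv.integrable_sq
  have hsub : Ioo (0 : ℝ) s ⊆ Ioo 0 1 := Ioo_subset_Ioo_right hs.2.le
  have iu : IntervalIntegrable (fun t => u t ^ 2) volume 0 s :=
    (intervalIntegrable_iff_integrableOn_Ioo_of_le hs.1.le).2 (hu2.mono_set hsub)
  have iv : IntervalIntegrable (fun t => v t ^ 2) volume 0 s :=
    (intervalIntegrable_iff_integrableOn_Ioo_of_le hs.1.le).2 (hv2.mono_set hsub)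
  have iu' : IntervalIntegrable (fun t => u (s - t) ^ 2) volume 0 s := by
    have := (iu.comp_sub_left s).symm
    simpa using this
  have key : ∀ w : ℝ → ℝ, IntegrableOn (fun t => w t ^ 2) (Ioo (0 : ℝ) 1) →
      ∫ t in (0 : ℝ)..s, w t ^ 2 ≤ ∫ t in Ioo (0 : ℝ) 1, w t ^ 2 := by
    intro w hw
    rw [intervalIntegral.integral_of_le hs.1.le, integral_Ioc_eq_integral_Ioo]
    exact setIntegral_mono_set hw (Filter.Eventually.of_forall fun t => sq_nonneg _)
      (Filter.Eventually.of_forall hsub)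
  have e : ∫ t in (0 : ℝ)..s, u (s - t) ^ 2 = ∫ t in (0 : ℝ)..s, u t ^ 2 := by
    have := intervalIntegral.integral_comp_sub_left (a := 0) (b := s) (fun t => u t ^ 2) s
    simpa using this
  have h1 : ‖∫ t in (0 : ℝ)..s, u (s - t) * v t‖ ≤
      ∫ t in (0 : ℝ)..s, (u (s - t) ^ 2 + v t ^ 2) := by
    refine intervalIntegral.norm_integral_le_of_norm_le hs.1.le
      (Filter.Eventually.of_forall fun t _ => ?_) (iu'.add iv)
    rw [Real.norm_eq_abs, abs_mul]
    nlinarith [sq_nonneg (|u (s - t)| - |v t|), sq_abs (u (s - t)), sq_abs (v t),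
      sq_nonneg (u (s - t)), sq_nonneg (v t)]
  rw [intervalIntegral.integral_add iu' iv, e] at h1
  rw [conv, ← Real.norm_eq_abs]
  linarith [key u hu2, key v hv2]

theorem memLp_conv {σ : ℝ} (u v : L2w σ) : MemLp (conv u v) 2 (weightedMeasure σ) := by
  have hac : weightedMeasure σ ≪ volume.restrict (Ioo (0 : ℝ) 1) :=
    withDensity_absolutelyContinuous _ _
  have hmeas : AEStronglyMeasurable (conv u v) (volume.restrict (Ioo (0 : ℝ) 1)) := by
    have h : StronglyMeasurable fun p : ℝ × ℝ =>
        {p : ℝ × ℝ | 0 < p.2 ∧ p.2 ≤ p.1}.indicator (fun p => u (p.1 - p.2) * v p.2) p := by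
      refine StronglyMeasurable.indicator ?_ ?_
      · exact ((Lp.stronglyMeasurable u).comp_measurable
          (measurable_fst.sub measurable_snd)).mul
          ((Lp.stronglyMeasurable v).comp_measurable measurable_snd)
      · exact (measurableSet_lt measurable_const measurable_snd).inter
          (measurableSet_le measurable_snd measurable_fst)
    have h2 := h.integral_prod_right' (ν := (volume : Measure ℝ))
    refine h2.aestronglyMeasurable.congr ?_
    refine (ae_restrict_iff' measurableSet_Ioo).2 (Filter.Eventually.of_forall fun s hs => ?_)
    simp only [conv]
    rw [intervalIntegral.integral_of_le hs.1.le, ← integral_indicator measurableSet_Ioc]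
    refine integral_congr_ae (Filter.Eventually.of_forall fun t => ?_)
    by_cases ht : 0 < t ∧ t ≤ s
    · simp [Set.indicator, ht]
    · simp [Set.indicator, ht]
  refine MemLp.of_bound (hmeas.mono_ac hac)
    ((∫ t in Ioo (0 : ℝ) 1, u t ^ 2) + ∫ t in Ioo (0 : ℝ) 1, v t ^ 2)
    (Filter.Eventually.filter_mono hac.ae_le ?_)
  refine (ae_restrict_iff' measurableSet_Ioo).2 (Filter.Eventually.of_forall fun s hs => ?_)
  rw [Real.norm_eq_abs]
  exact abs_conv_le (memLp_restrict u) (memLp_restrict v) hs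

/-- The convolution as a map on `L₂^σ(0,1)`. -/
def convL2 {σ : ℝ} (u v : L2w σ) : L2w σ := (memLp_conv u v).toLp _

/-- The autoconvolution operator `[F(x)](s) = ∫₀ˢ x(s-t) x(t) dt`. -/
def autoconv {σ : ℝ} (x : L2w σ) : L2w σ := convL2 x x

/-- Its Fréchet derivative `[F'(x)h](s) = 2 ∫₀ˢ x(s-t) h(t) dt`. -/
def autoconvDeriv {σ : ℝ} (x h : L2w σ) : L2w σ := (2 : ℝ) • convL2 x h

/-- The constant function with value `a`. -/
def constFun (σ a : ℝ) : L2w σ := Lp.const 2 (weightedMeasure σ) a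

/-- The unweighted norm `(∫₀¹ x(t)² dt)^{1/2}`. -/
def l2norm {σ : ℝ} (x : L2w σ) : ℝ := Real.sqrt (∫ t in Ioo (0 : ℝ) 1, x t ^ 2)

/-- `x` is (almost everywhere equal to) an absolutely continuous function on `[0,1]`
with derivative `x' ∈ L₂(0,1)`. -/
def HasL2Deriv {σ : ℝ} (x x' : L2w σ) : Prop :=
  ∃ a : ℝ, ∀ᵐ t ∂(volume.restrict (Ioo (0 : ℝ) 1)), x t = a + ∫ s in (0 : ℝ)..t, x' s

/-- The norm `½ (‖x‖_σ² + ‖x'‖_σ²)^{1/2}` of an element of `H₁^σ(0,1)` with derivative `x'`. -/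
def h1norm {σ : ℝ} (x x' : L2w σ) : ℝ := 1 / 2 * Real.sqrt (‖x‖ ^ 2 + ‖x'‖ ^ 2)

/-- The spaces `X m` have dimension `m` and the approximation power `L / m`
for `H₁^σ(0,1)` in `L₂^σ(0,1)`, for `m = 1, 2, …`. -/
structure ApproximationPower {σ : ℝ} (X : ℕ → Submodule ℝ (L2w σ)) (L : ℝ) : Prop where
  finrank_eq : ∀ m : ℕ, 1 ≤ m → Module.finrank ℝ (X m) = m
  approx : ∀ m : ℕ, 1 ≤ m → ∀ x x' : L2w σ, HasL2Deriv x x' →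
    (⨅ z : X m, ‖x - (z : L2w σ)‖) ≤ L / m * h1norm x x'

/-- `f`, as a function on `[0,1]`, is the `C¹` representative of an element of `W²_∞(0,1)`:
it is absolutely continuous, so is its derivative `f'`, and `f''` is essentially bounded. -/
def IsW2Inf (f : ℝ → ℝ) : Prop :=
  ∃ f' f'' : ℝ → ℝ, MemLp f'' ⊤ (volume.restrict (Ioo (0 : ℝ) 1)) ∧
    (∀ t ∈ Icc (0 : ℝ) 1, f' t = f' 0 + ∫ s in (0 : ℝ)..t, f'' s) ∧
    (∀ t ∈ Icc (0 : ℝ) 1, f t = f 0 + ∫ s in (0 : ℝ)..t, f' s)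

/-- The true solution `x₀` has the continuous representative `f` of class `W²_∞(0,1)`, which is
positive on `(0,1)` with `f 0 > 0`. -/
structure SolutionSmoothness {σ : ℝ} (x₀ : L2w σ) (f : ℝ → ℝ) : Prop where
  repr : ∀ᵐ t ∂(volume.restrict (Ioo (0 : ℝ) 1)), x₀ t = f t
  w2inf : IsW2Inf f
  pos : ∀ t ∈ Ioo (0 : ℝ) 1, 0 < f t
  pos_zero : 0 < f 0

/-- The value at `s ∈ [0,1]` of the `L₂(0,1)`-orthogonal projection of `y` onto the functions
that are constant on each `[i/m, (i+1)/m)`, `i < m` (the last interval is closed), namely the mean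
of `y` over the interval containing `s`. -/
def pwConstProj (m : ℕ) (y : ℝ → ℝ) (s : ℝ) : ℝ :=
  let i : ℕ := min ⌊(m : ℝ) * s⌋₊ (m - 1)
  (m : ℝ) * ∫ t in ((i : ℝ) / m)..(((i : ℝ) + 1) / m), y t

/-- The value of the constant reference element `x_*` computed from the data `y`. -/
def refValue (m : ℕ) (δ : ℝ) (y : ℝ → ℝ) : ℝ :=
  if 0 ≤ pwConstProj m y (Real.sqrt δ) then
    Real.sqrt (1 / Real.sqrt δ * pwConstProj m y (Real.sqrt δ))
  else 0

/-- `x` solves `α Q (x_* - x) + Q y = Q F(Q x)`, where `Q` is the orthogonal projection of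
`L₂^σ(0,1)` onto the subspace `V`. -/
def SolvesLavrentiev {σ : ℝ} (V : Submodule ℝ (L2w σ)) [FiniteDimensional ℝ V]
    (α : ℝ) (xstar y x : L2w σ) : Prop :=
  α • V.starProjection (xstar - x) + V.starProjection y =
    V.starProjection (autoconv (V.starProjection x))

end Autoconv

end

/-!
The convolution of `L₂^σ(0,1)` is commutative, associative and, because the weight `e^{-2σt}` is the
square of a multiplicative function, satisfies `‖u * v‖_σ ≤ ‖u‖_σ ‖v‖_σ` (`norm_convL2_le`). With
`A = F'(x₀)` one has `F(x₀ + e) = F(x₀) + A e + F(e)`, so a solution `x = Q x₀ + h` of the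
discretized equation satisfies, up to discretization errors,
`(α + Q A) h = α Q (x_* - x₀) + Q (y^δ - F(x₀)) - Q F(h)`.

Accretivity gives `‖(α + Q A)⁻¹‖ ≤ 1 / α` and `‖(α + Q A)⁻¹ Q A‖ ≤ 1` on `X_m`. Writing
`x₀ - x₀(0) = A ω`, the norm `r α` of a solution is therefore controlled by
`‖ω‖ + (error terms) + r² ≤ r`. Since `‖ω‖ < 1 / 4`, this has room for some `r < 1 / 2` as soon as
the error terms are small, and `r < 1 / 2` is also what makes the fixed point map a contraction on the
ball of radius `r α` (`exists_galerkin_solution`).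

The error terms, relative to `α = c √δ`, are `O(1 / c)`:
* `x_* - x₀(0) = O(√δ)`, because `F(x₀)(s) = s x₀(0)² + O(s²)` (`exists_abs_refValue_sub_le`);
* `x₀` and `ω` both belong to `H₁`, so that the spaces `X_m` with `1 / m ≤ δ / σ` approximate them
  up to `O(δ)`. Existence and smoothness of `ω` come from differentiating the first-kind equation
  `A ω = x₀ - x₀(0)` to a Volterra equation of the second kind (`exists_source`), which is solvable
  because convolution with a fixed function is a contraction in `L₂^τ(0,1)` for large `τ`
  (`exists_add_convL2_eq`).
-/

/-! ### Accretive operators and the Galerkin equations -/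

/-- On a finite-dimensional space `α + A` with `A` accretive and `α > 0` is invertible; its
inverse `R` satisfies `‖R‖ ≤ 1 / α` and `‖A R‖ ≤ 1`. -/
theorem exists_resolvent_of_accretive {E : Type*} [NormedAddCommGroup E] [InnerProductSpace ℝ E]
    [FiniteDimensional ℝ E] (A : E →ₗ[ℝ] E) (hA : ∀ v, 0 ≤ inner ℝ (A v) v) {α : ℝ}
    (hα : 0 < α) :
    ∃ R : E →ₗ[ℝ] E, (∀ v, α • R v + A (R v) = v) ∧
      (∀ v, ‖R v‖ ≤ ‖v‖ / α) ∧ ∀ v, ‖A (R v)‖ ≤ ‖v‖ := by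
  have key : ∀ u, (α * ‖u‖) ^ 2 + ‖A u‖ ^ 2 ≤ ‖α • u + A u‖ ^ 2 := by
    intro u
    have h := norm_add_sq_real (α • u) (A u)
    rw [norm_smul, Real.norm_eq_abs, abs_of_pos hα, real_inner_smul_left, real_inner_comm] at h
    nlinarith [mul_nonneg hα.le (hA u)]
  have hinj : Function.Injective (α • LinearMap.id + A : E →ₗ[ℝ] E) := by
    rw [injective_iff_map_eq_zero]
    intro u hu
    have hu' : α • u + A u = 0 := by simpa using hu
    have h := key u
    rw [hu', norm_zero] at h
    have h0 : (α * ‖u‖) ^ 2 = 0 := le_antisymm (by nlinarith [sq_nonneg ‖A u‖]) (sq_nonneg _)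
    simpa [hα.ne'] using h0
  set M := LinearEquiv.ofInjectiveEndo (α • LinearMap.id + A : E →ₗ[ℝ] E) hinj with hM
  have hMapp : ∀ v, M v = α • v + A v := fun v => by
    simp [hM]
  have h1 : ∀ v, α • M.symm v + A (M.symm v) = v := fun v => by
    rw [← hMapp, LinearEquiv.apply_symm_apply]
  refine ⟨M.symm.toLinearMap, h1, fun v => ?_, fun v => ?_⟩
  · have h := key (M.symm v)
    rw [h1] at h
    rw [le_div_iff₀ hα, mul_comm]
    exact abs_le_of_sq_le_sq' (by
      change (α * ‖M.symm v‖) ^ 2 ≤ _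
      nlinarith [sq_nonneg ‖A (M.symm v)‖]) (norm_nonneg _) |>.2
  · have h := key (M.symm v)
    rw [h1] at h
    exact abs_le_of_sq_le_sq' (by
      change ‖A (M.symm v)‖ ^ 2 ≤ _
      nlinarith [sq_nonneg (α * ‖M.symm v‖)]) (norm_nonneg _) |>.2

theorem norm_bilin_diag_sub_le {H : Type*} [NormedAddCommGroup H] [NormedSpace ℝ H]
    (B : H →ₗ[ℝ] H →ₗ[ℝ] H) (hB : ∀ u v, ‖B u v‖ ≤ ‖u‖ * ‖v‖) (hsymm : ∀ u v, B u v = B v u)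
    (u v : H) : ‖B u u - B v v‖ ≤ (‖u‖ + ‖v‖) * ‖u - v‖ := by
  have h : B u u - B v v = B (u + v) (u - v) := by
    simp only [map_add, map_sub, LinearMap.add_apply]
    rw [hsymm v u]
    abel
  rw [h]
  exact (hB _ _).trans (by gcongr; exact norm_add_le _ _)

/-- Solvability of the Galerkin equations of Lavrent'ev regularization for the quadratic operator
`x ↦ B x x` near a point `x₀` with a source representation `x₀ - z = 2 B x₀ ω`, given that the
discretization errors and the data error are small compared to the regularization parameter. -/
theorem exists_galerkin_solution {H : Type*} [NormedAddCommGroup H] [InnerProductSpace ℝ H]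
    (V : Submodule ℝ H) [FiniteDimensional ℝ V]
    (B : H →ₗ[ℝ] H →ₗ[ℝ] H) (hB : ∀ u v, ‖B u v‖ ≤ ‖u‖ * ‖v‖) (hsymm : ∀ u v, B u v = B v u)
    (x₀ : H) (hacc : ∀ v, 0 ≤ inner ℝ ((2 : ℝ) • B x₀ v) v) (ω z xs y : H)
    (hω : (2 : ℝ) • B x₀ ω = x₀ - z) {α η r : ℝ} (hα : 0 < α) (hr0 : 0 ≤ r)
    (hp : ‖x₀ - V.starProjection x₀‖ ≤ α * η)
    (hg : α * ‖xs - z‖ + ‖y - B x₀ x₀‖ +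
      2 * ‖x₀‖ * (‖x₀ - V.starProjection x₀‖ + α * ‖ω - V.starProjection ω‖) ≤ α ^ 2 * η)
    (hη : ‖ω‖ + η + (r + η) ^ 2 ≤ r) (hrη : r + η < 1 / 2) :
    ∃ x ∈ V, α • V.starProjection (xs - x) + V.starProjection y =
        V.starProjection (B (V.starProjection x) (V.starProjection x)) ∧ ‖x₀ - x‖ ≤ α := by
  set P : H →L[ℝ] V := V.orthogonalProjectionOnto with hP
  have hPn : ∀ u, ‖P u‖ ≤ ‖u‖ := fun u => V.norm_orthogonalProjectionOnto_apply_le u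
  have hQ : ∀ u, V.starProjection u = (P u : H) := fun u => rfl
  set A : H →ₗ[ℝ] H := (2 : ℝ) • B x₀ with hAdef
  have hAn : ∀ u, ‖A u‖ ≤ 2 * ‖x₀‖ * ‖u‖ := fun u => by
    simp only [hAdef, LinearMap.smul_apply, norm_smul]
    have := hB x₀ u
    norm_num
    linarith
  set A' : V →ₗ[ℝ] V := P.toLinearMap ∘ₗ A ∘ₗ V.subtype with hA'
  have hA'app : ∀ v : V, A' v = P (A v) := fun v => rfl
  have hA'acc : ∀ v, 0 ≤ inner ℝ (A' v) v := fun v => by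
    have h : inner ℝ (A' v) v = inner ℝ (A v) (v : H) :=
      Submodule.inner_orthogonalProjectionOnto_eq_of_mem_right v (A v)
    rw [h]
    exact hacc v
  obtain ⟨R, hR1, hR3, hR4⟩ := exists_resolvent_of_accretive A' hA'acc hα
  set p : H := x₀ - P x₀ with hpdef
  set q : H := ω - P ω with hqdef
  set g : V := α • P (xs - z) + P (y - B x₀ x₀) + P (A p) - α • P (A q) with hgdef
  have hgn : ‖g‖ ≤ α ^ 2 * η := by
    refine le_trans ?_ hg
    have e1 : ‖α • P (xs - z)‖ ≤ α * ‖xs - z‖ := by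
      rw [norm_smul, Real.norm_eq_abs, abs_of_pos hα]
      gcongr; exact hPn _
    have e2 : ‖α • P (A q)‖ ≤ α * (2 * ‖x₀‖ * ‖q‖) := by
      rw [norm_smul, Real.norm_eq_abs, abs_of_pos hα]
      gcongr; exact (hPn _).trans (hAn _)
    have e3 := hPn (y - B x₀ x₀)
    have e4 := (hPn (A p)).trans (hAn p)
    have e5 := norm_sub_le (α • P (xs - z) + P (y - B x₀ x₀) + P (A p)) (α • P (A q))
    have e6 := norm_add_le (α • P (xs - z) + P (y - B x₀ x₀)) (P (A p))
    have e7 := norm_add_le (α • P (xs - z)) (P (y - B x₀ x₀))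
    change _ ≤ α * ‖xs - z‖ + ‖y - B x₀ x₀‖ + 2 * ‖x₀‖ * (‖p‖ + α * ‖q‖)
    linarith
  have hpn : ‖p‖ ≤ α * η := hp
  set T : V → V := fun h => R (g - P (B (h - p) (h - p))) - α • A' (R (P ω)) with hT
  have hball : ∀ h : V, ‖h‖ ≤ r * α → ‖(h : H) - p‖ ≤ (r + η) * α := fun h hh => by
    have := norm_sub_le (h : H) p
    have h' : ‖(h : H)‖ ≤ r * α := hh
    linarith
  have hmaps : MapsTo T (Metric.closedBall 0 (r * α)) (Metric.closedBall 0 (r * α)) := by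
    intro h hh
    rw [mem_closedBall_zero_iff] at hh ⊢
    have e1 : ‖g - P (B (h - p) (h - p))‖ ≤ α ^ 2 * η + ((r + η) * α) ^ 2 := by
      refine (norm_sub_le _ _).trans (add_le_add hgn ?_)
      refine (hPn _).trans ((hB _ _).trans ?_)
      rw [← sq]
      exact pow_le_pow_left₀ (norm_nonneg _) (hball h hh) 2
    have e2 : ‖R (g - P (B (h - p) (h - p)))‖ ≤ α * η + (r + η) ^ 2 * α := by
      refine (hR3 _).trans ?_
      rw [div_le_iff₀ hα]
      nlinarith
    have e3 : ‖α • A' (R (P ω))‖ ≤ α * ‖ω‖ := by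
      rw [norm_smul, Real.norm_eq_abs, abs_of_pos hα]
      gcongr
      exact (hR4 _).trans (hPn _)
    refine (norm_sub_le _ _).trans ?_
    nlinarith
  have hK0 : 0 ≤ 2 * (r + η) := by
    have := (norm_nonneg p).trans hpn
    have : 0 ≤ η := by
      by_contra hc
      nlinarith
    linarith
  have hlip : ∀ h h' : V, ‖h‖ ≤ r * α → ‖h'‖ ≤ r * α →
      ‖T h - T h'‖ ≤ 2 * (r + η) * ‖h - h'‖ := by
    intro h h' hh hh'
    have e : T h - T h' = R (P (B (h' - p) (h' - p) - B (h - p) (h - p))) := by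
      simp only [hT, map_sub]
      abel
    rw [e]
    refine (hR3 _).trans ?_
    rw [div_le_iff₀ hα]
    refine (hPn _).trans ((norm_bilin_diag_sub_le B hB hsymm _ _).trans ?_)
    have e2 : ((h' : H) - p) - (h - p) = -((h - h' : V) : H) := by
      push_cast
      abel
    rw [e2, norm_neg]
    have e3 := hball h hh
    have e4 := hball h' hh'
    change _ * ‖h - h'‖ ≤ _
    nlinarith [norm_nonneg (h - h')]
  have hcontr : ContractingWith (Real.toNNReal (2 * (r + η))) (hmaps.restrict T _ _) := by
    refine ⟨?_, ?_⟩
    · rw [Real.toNNReal_lt_one]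
      linarith
    · refine LipschitzWith.of_dist_le_mul fun a b => ?_
      have ha := mem_closedBall_zero_iff.1 a.2
      have hb := mem_closedBall_zero_iff.1 b.2
      have := hlip a b ha hb
      rw [← dist_eq_norm, ← dist_eq_norm] at this
      rw [Real.coe_toNNReal _ hK0]
      exact this
  obtain ⟨h, hhs, hfix, -⟩ := hcontr.exists_fixedPoint' Metric.isClosed_closedBall.isComplete
    hmaps (x := 0) (by simp; positivity) (edist_ne_top _ _)
  rw [mem_closedBall_zero_iff] at hhs
  have heq : α • h + A' h = g - P (B (h - p) (h - p)) - α • A' (P ω) := by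
    have e1 := hR1 (g - P (B (h - p) (h - p)))
    have e2 := congrArg A' (hR1 (P ω))
    have e3 : T h = h := hfix
    simp only [hT] at e3
    rw [map_add, map_smul] at e2
    rw [← e1, ← e2]
    conv_lhs => rw [← e3]
    simp only [map_sub, map_smul, smul_add, smul_sub]
    abel
  refine ⟨P x₀ + h, V.add_mem (P x₀).2 h.2, ?_, ?_⟩
  · have hx : V.starProjection ((P x₀ : H) + h) = (P x₀ : H) + h :=
      Submodule.starProjection_eq_self_iff.2 (V.add_mem (P x₀).2 h.2)
    have hPV : ∀ v : V, P (v : H) = v := fun v => V.orthogonalProjectionOnto_mem_subspace_eq_self v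
    rw [hx]
    have hxe : (P x₀ : H) + h = x₀ + (h - p) := by
      rw [hpdef]; abel
    have hF : B ((P x₀ : H) + h) ((P x₀ : H) + h) =
        B x₀ x₀ + (A h - A p) + B (h - p) (h - p) := by
      rw [hxe, ← map_sub]
      simp only [map_add, LinearMap.add_apply, hAdef, two_smul]
      rw [hsymm ((h : H) - p) x₀]
      abel
    have e1 : P x₀ = P z + (P (A q) + A' (P ω)) := by
      have : x₀ = z + (A q + A (P ω)) := by
        rw [← map_add, hqdef, sub_add_cancel]
        have h2 : A ω = x₀ - z := hω
        rw [h2]; abel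
      conv_lhs => rw [this]
      simp only [map_add, hA'app]
    have goal : α • P (xs - (P x₀ + h)) + P y = P (B ((P x₀ : H) + h) ((P x₀ : H) + h)) := by
      rw [hF]
      simp only [map_add, map_sub, hPV]
      have e2 := heq
      rw [hgdef, hA'app] at e2
      simp only [map_sub, smul_sub] at e2
      rw [e1]
      simp only [smul_add, smul_sub]
      have e3 : P ((B ↑h) ↑h) - P ((B p) ↑h) - (P ((B ↑h) p) - P ((B p) p)) =
        α • P xs - α • P z + (P y - P ((B x₀) x₀)) + P (A p) - α • P (A q) - α • A' (P ω)
          - (α • h + P (A h)) := by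
        rw [e2]
        simp only [map_sub, LinearMap.sub_apply]
        abel
      simp only [map_sub, LinearMap.sub_apply] at e3 ⊢
      rw [e3]
      abel
    simp only [hQ]
    exact_mod_cast congrArg (Subtype.val) goal
  · have hxe : x₀ - ((P x₀ : H) + h) = -((h : H) - p) := by
      rw [hpdef]; abel
    rw [hxe, norm_neg]
    refine (hball h hhs).trans ?_
    nlinarith

/-! ### Convolution in the weighted space -/

namespace Autoconv

theorem ae_weightedMeasure_iff {σ : ℝ} {p : ℝ → Prop} :
    (∀ᵐ t ∂weightedMeasure σ, p t) ↔ ∀ᵐ t ∂volume.restrict (Ioo (0 : ℝ) 1), p t := by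
  refine ⟨fun h => ?_, fun h => (withDensity_absolutelyContinuous _ _).ae_le h⟩
  exact (Measure.absolutelyContinuous_of_le_smul
    (restrict_le_smul_weightedMeasure σ)).ae_le h

theorem L2w_ext {σ : ℝ} {u v : L2w σ}
    (h : ∀ᵐ t ∂volume.restrict (Ioo (0 : ℝ) 1), u t = v t) : u = v :=
  Lp.ext (ae_weightedMeasure_iff.2 h)

theorem integral_weightedMeasure (σ : ℝ) (g : ℝ → ℝ) :
    ∫ t, g t ∂weightedMeasure σ = ∫ t in Ioo (0 : ℝ) 1, Real.exp (-2 * σ * t) * g t := by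
  rw [weightedMeasure, integral_withDensity_eq_integral_toReal_smul (by fun_prop)
    (Filter.Eventually.of_forall fun _ => ENNReal.ofReal_lt_top)]
  simp [ENNReal.toReal_ofReal, Real.exp_nonneg]

theorem norm_sq_L2w {σ : ℝ} (u : L2w σ) :
    ‖u‖ ^ 2 = ∫ t in Ioo (0 : ℝ) 1, Real.exp (-2 * σ * t) * u t ^ 2 := by
  rw [← integral_weightedMeasure σ fun t => u t ^ 2, ← real_inner_self_eq_norm_sq, L2.inner_def]
  simp [sq]

theorem norm_le_of_abs_le {σ : ℝ} (hσ : 0 ≤ σ) {u : L2w σ} {a : ℝ} (ha : 0 ≤ a)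
    (h : ∀ᵐ t ∂volume.restrict (Ioo (0 : ℝ) 1), |u t| ≤ a) : ‖u‖ ≤ a := by
  refine abs_le_of_sq_le_sq' ?_ ha |>.2
  rw [norm_sq_L2w]
  have : ∫ t in Ioo (0 : ℝ) 1, a ^ 2 = a ^ 2 := by simp
  rw [← this]
  refine integral_mono_of_nonneg (Filter.Eventually.of_forall fun t => by positivity)
    (integrable_const _) ?_
  filter_upwards [h, ae_restrict_mem measurableSet_Ioo] with t ht ht1
  have h1 : Real.exp (-2 * σ * t) ≤ 1 := Real.exp_le_one_iff.2 (by nlinarith [ht1.1])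
  have h2 : u t ^ 2 ≤ a ^ 2 := sq_le_sq' (abs_le.1 ht).1 (abs_le.1 ht).2
  nlinarith [sq_nonneg (u t)]

/-- The Cauchy–Schwarz inequality for the integral. -/
theorem sq_integral_mul_le {α : Type*} [MeasurableSpace α] {μ : Measure α} {f g : α → ℝ}
    (hf : MemLp f 2 μ) (hg : MemLp g 2 μ) :
    (∫ t, f t * g t ∂μ) ^ 2 ≤ (∫ t, f t ^ 2 ∂μ) * ∫ t, g t ^ 2 ∂μ := by
  have hfg : Integrable (fun t => f t * g t) μ := hf.integrable_mul hg
  have key : ∀ x : ℝ, 0 ≤ (∫ t, f t ^ 2 ∂μ) * (x * x) + (2 * ∫ t, f t * g t ∂μ) * x +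
      ∫ t, g t ^ 2 ∂μ := by
    intro x
    have h : 0 ≤ ∫ t, (x * f t + g t) ^ 2 ∂μ := integral_nonneg fun t => sq_nonneg _
    have e : ∫ t, (x * f t + g t) ^ 2 ∂μ =
        ∫ t, ((x * x) * f t ^ 2 + (2 * x) * (f t * g t) + g t ^ 2) ∂μ :=
      integral_congr_ae (Filter.Eventually.of_forall fun t => by ring)
    rw [e, integral_add, integral_add, integral_const_mul, integral_const_mul] at h
    · linarith
    · exact hf.integrable_sq.const_mul _
    · exact hfg.const_mul _
    · exact (hf.integrable_sq.const_mul _).add (hfg.const_mul _)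
    · exact hg.integrable_sq
  have := discrim_le_zero key
  rw [discrim] at this
  linarith

theorem conv_comm (u v : ℝ → ℝ) (s : ℝ) : conv u v s = conv v u s := by
  have := intervalIntegral.integral_comp_sub_left (a := 0) (b := s)
    (fun t => u (s - t) * v t) s
  simp only [sub_sub_cancel, sub_zero, sub_self] at this
  rw [conv, conv, ← this]
  simp only [mul_comm]

theorem memLp_comp_sub_left {u : ℝ → ℝ} (hu : MemLp u 2 (volume.restrict (Ioo (0 : ℝ) 1)))
    {s : ℝ} (hs : s ≤ 1) : MemLp (fun t => u (s - t)) 2 (volume.restrict (Ioo 0 s)) := by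
  have hmp : MeasurePreserving (fun t : ℝ => s - t) (volume.restrict (Ioo 0 s))
      (volume.restrict (Ioo 0 s)) := by
    have := (Measure.measurePreserving_sub_left volume s).restrict_preimage
      (measurableSet_Ioo (a := 0) (b := s))
    simpa using this
  exact (hu.mono_measure
    (Measure.restrict_mono (Ioo_subset_Ioo_right hs) le_rfl)).comp_measurePreserving hmp

theorem memLp_Ioo {u : ℝ → ℝ} (hu : MemLp u 2 (volume.restrict (Ioo (0 : ℝ) 1)))
    {s : ℝ} (hs : s ≤ 1) : MemLp u 2 (volume.restrict (Ioo 0 s)) :=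
  hu.mono_measure (Measure.restrict_mono (Ioo_subset_Ioo_right hs) le_rfl)

theorem intervalIntegrable_conv {u v : ℝ → ℝ}
    (hu : MemLp u 2 (volume.restrict (Ioo (0 : ℝ) 1)))
    (hv : MemLp v 2 (volume.restrict (Ioo (0 : ℝ) 1))) {s : ℝ} (hs : s ∈ Icc (0 : ℝ) 1) :
    IntervalIntegrable (fun t => u (s - t) * v t) volume 0 s :=
  (intervalIntegrable_iff_integrableOn_Ioo_of_le hs.1).2
    ((memLp_comp_sub_left hu hs.2).integrable_mul (memLp_Ioo hv hs.2))

theorem conv_congr_right {u v v' : ℝ → ℝ}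
    (hv : ∀ᵐ t ∂volume.restrict (Ioo (0 : ℝ) 1), v t = v' t)
    {s : ℝ} (hs : s ∈ Icc (0 : ℝ) 1) : conv u v s = conv u v' s := by
  refine intervalIntegral.integral_congr_ae_restrict ?_
  rw [uIoc_of_le hs.1, ← Measure.restrict_congr_set Ioo_ae_eq_Ioc]
  filter_upwards [ae_restrict_of_ae_restrict_of_subset (Ioo_subset_Ioo_right hs.2) hv] with t ht
  rw [ht]

theorem conv_congr {u u' v v' : ℝ → ℝ}
    (hu : ∀ᵐ t ∂volume.restrict (Ioo (0 : ℝ) 1), u t = u' t)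
    (hv : ∀ᵐ t ∂volume.restrict (Ioo (0 : ℝ) 1), v t = v' t)
    {s : ℝ} (hs : s ∈ Icc (0 : ℝ) 1) : conv u v s = conv u' v' s := by
  rw [conv_congr_right hv hs, conv_comm, conv_congr_right hu hs, conv_comm]

theorem conv_add_left {u u' v : ℝ → ℝ}
    (hu : MemLp u 2 (volume.restrict (Ioo (0 : ℝ) 1)))
    (hu' : MemLp u' 2 (volume.restrict (Ioo (0 : ℝ) 1)))
    (hv : MemLp v 2 (volume.restrict (Ioo (0 : ℝ) 1))) {s : ℝ} (hs : s ∈ Icc (0 : ℝ) 1) :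
    conv (fun t => u t + u' t) v s = conv u v s + conv u' v s := by
  simp only [conv, add_mul]
  exact intervalIntegral.integral_add (intervalIntegrable_conv hu hv hs)
    (intervalIntegrable_conv hu' hv hs)

theorem conv_smul_left (a : ℝ) (u v : ℝ → ℝ) (s : ℝ) :
    conv (fun t => a * u t) v s = a * conv u v s := by
  simp only [conv, mul_assoc]
  exact intervalIntegral.integral_const_mul _ _

theorem coeFn_convL2 {σ : ℝ} (u v : L2w σ) :
    ∀ᵐ t ∂volume.restrict (Ioo (0 : ℝ) 1), convL2 u v t = conv u v t :=
  ae_weightedMeasure_iff.1 (memLp_conv u v).coeFn_toLp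

/-- The exponential weight is multiplicative, so that `e^{-σs} (u * v)(s)` is the convolution of
`e^{-σt} u` and `e^{-σt} v`; the Cauchy–Schwarz inequality bounds it pointwise. -/
theorem exp_mul_abs_conv_le {σ : ℝ} (u v : L2w σ) {s : ℝ} (hs : s ∈ Ioo (0 : ℝ) 1) :
    Real.exp (-2 * σ * s) * conv u v s ^ 2 ≤ ‖u‖ ^ 2 * ‖v‖ ^ 2 := by
  have hw : ∀ w : L2w σ, MemLp (fun t => Real.exp (-σ * t) * w t) 2
      (volume.restrict (Ioo (0 : ℝ) 1)) := fun w => by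
    refine (memLp_restrict w).of_le_mul (c := Real.exp |σ|)
      ((by fun_prop : Measurable fun t : ℝ => Real.exp (-σ * t)).aestronglyMeasurable.mul
        (memLp_restrict w).1) ?_
    filter_upwards [ae_restrict_mem measurableSet_Ioo] with t ht
    rw [norm_mul, Real.norm_eq_abs (Real.exp _), Real.abs_exp]
    gcongr
    have h1 : -σ * t ≤ |σ| * t := mul_le_mul_of_nonneg_right (neg_le_abs σ) ht.1.le
    have h2 : |σ| * t ≤ |σ| * 1 := mul_le_mul_of_nonneg_left ht.2.le (abs_nonneg σ)
    linarith
  have hn : ∀ w : L2w σ, ∫ t in Ioo (0 : ℝ) s, (Real.exp (-σ * t) * w t) ^ 2 ≤ ‖w‖ ^ 2 := by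
    intro w
    have e : ∫ t in Ioo (0 : ℝ) 1, Real.exp (-2 * σ * t) * w t ^ 2 =
        ∫ t in Ioo (0 : ℝ) 1, (Real.exp (-σ * t) * w t) ^ 2 := by
      refine integral_congr_ae (Filter.Eventually.of_forall fun t => ?_)
      simp only [mul_pow, ← Real.exp_nat_mul]
      congr 2
      push_cast
      ring
    rw [norm_sq_L2w, e]
    exact setIntegral_mono_set (hw w).integrable_sq
      (Filter.Eventually.of_forall fun t => sq_nonneg _)
      (Filter.Eventually.of_forall (Ioo_subset_Ioo_right hs.2.le))
  have hrefl : ∫ t in Ioo (0 : ℝ) s, (Real.exp (-σ * (s - t)) * u (s - t)) ^ 2 =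
      ∫ t in Ioo (0 : ℝ) s, (Real.exp (-σ * t) * u t) ^ 2 := by
    have := intervalIntegral.integral_comp_sub_left (a := 0) (b := s)
      (fun t => (Real.exp (-σ * t) * u t) ^ 2) s
    rw [sub_self, sub_zero, intervalIntegral.integral_of_le hs.1.le,
      intervalIntegral.integral_of_le hs.1.le, integral_Ioc_eq_integral_Ioo,
      integral_Ioc_eq_integral_Ioo] at this
    exact this
  have e : Real.exp (-2 * σ * s) * conv u v s ^ 2 =
      (∫ t in Ioo (0 : ℝ) s, (Real.exp (-σ * (s - t)) * u (s - t)) *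
        (Real.exp (-σ * t) * v t)) ^ 2 := by
    have e1 : ∀ t, (Real.exp (-σ * (s - t)) * u (s - t)) * (Real.exp (-σ * t) * v t) =
        Real.exp (-σ * s) * (u (s - t) * v t) := fun t => by
      have : Real.exp (-σ * s) = Real.exp (-σ * (s - t)) * Real.exp (-σ * t) := by
        rw [← Real.exp_add]; congr 1; ring
      rw [this]; ring
    simp only [e1]
    rw [integral_const_mul, ← integral_Ioc_eq_integral_Ioo,
      ← intervalIntegral.integral_of_le hs.1.le, mul_pow, ← Real.exp_nat_mul]
    rw [conv]
    congr 2
    push_cast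
    ring
  rw [e]
  refine (sq_integral_mul_le (memLp_comp_sub_left (hw u) hs.2.le)
    (memLp_Ioo (hw v) hs.2.le)).trans ?_
  rw [hrefl]
  exact mul_le_mul (hn u) (hn v) (integral_nonneg fun t => sq_nonneg _) (sq_nonneg _)

theorem norm_convL2_le {σ : ℝ} (u v : L2w σ) : ‖convL2 u v‖ ≤ ‖u‖ * ‖v‖ := by
  refine abs_le_of_sq_le_sq' ?_ (by positivity) |>.2
  rw [norm_sq_L2w, mul_pow]
  have : ∫ t in Ioo (0 : ℝ) 1, ‖u‖ ^ 2 * ‖v‖ ^ 2 = ‖u‖ ^ 2 * ‖v‖ ^ 2 := by simp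
  rw [← this]
  refine integral_mono_of_nonneg (Filter.Eventually.of_forall fun t => by positivity)
    (integrable_const _) ?_
  filter_upwards [coeFn_convL2 u v, ae_restrict_mem measurableSet_Ioo] with t ht ht1
  rw [ht]
  exact exp_mul_abs_conv_le u v ht1

theorem convL2_comm {σ : ℝ} (u v : L2w σ) : convL2 u v = convL2 v u := by
  refine L2w_ext ?_
  filter_upwards [coeFn_convL2 u v, coeFn_convL2 v u] with t h1 h2
  rw [h1, h2, conv_comm]

theorem convL2_add_left {σ : ℝ} (u u' v : L2w σ) :
    convL2 (u + u') v = convL2 u v + convL2 u' v := by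
  refine L2w_ext ?_
  filter_upwards [coeFn_convL2 (u + u') v, coeFn_convL2 u v, coeFn_convL2 u' v,
    ae_weightedMeasure_iff.1 (Lp.coeFn_add (convL2 u v) (convL2 u' v)),
    ae_restrict_mem measurableSet_Ioo] with t h1 h2 h3 h4 ht
  have ht' := Ioo_subset_Icc_self ht
  rw [h1, h4, Pi.add_apply, h2, h3, ← conv_add_left (memLp_restrict u) (memLp_restrict u')
    (memLp_restrict v) ht']
  exact conv_congr (ae_weightedMeasure_iff.1 (Lp.coeFn_add u u'))
    (Filter.Eventually.of_forall fun _ => rfl) ht'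

theorem convL2_smul_left {σ : ℝ} (a : ℝ) (u v : L2w σ) :
    convL2 (a • u) v = a • convL2 u v := by
  refine L2w_ext ?_
  filter_upwards [coeFn_convL2 (a • u) v, coeFn_convL2 u v,
    ae_weightedMeasure_iff.1 (Lp.coeFn_smul a (convL2 u v)),
    ae_restrict_mem measurableSet_Ioo] with t h1 h2 h4 ht
  rw [h1, h4, Pi.smul_apply, h2, smul_eq_mul, ← conv_smul_left]
  exact conv_congr (ae_weightedMeasure_iff.1 (Lp.coeFn_smul a u))
    (Filter.Eventually.of_forall fun _ => rfl) (Ioo_subset_Icc_self ht)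

/-- The convolution as a bilinear map on `L₂^σ(0,1)`. -/
noncomputable def convBilin (σ : ℝ) : L2w σ →ₗ[ℝ] L2w σ →ₗ[ℝ] L2w σ :=
  LinearMap.mk₂ ℝ convL2 convL2_add_left convL2_smul_left
    (fun u v v' => by rw [convL2_comm, convL2_add_left, convL2_comm v, convL2_comm v'])
    (fun a u v => by rw [convL2_comm, convL2_smul_left, convL2_comm v])

@[simp]
theorem convBilin_apply {σ : ℝ} (u v : L2w σ) : convBilin σ u v = convL2 u v := rfl

open ContinuousLinearMap in
theorem convolution_eq_conv {φ ψ : ℝ → ℝ} (hφ : ∀ t ≤ 0, φ t = 0) (hψ : ∀ t ≤ 0, ψ t = 0)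
    {s : ℝ} (hs : 0 ≤ s) : convolution ψ φ (mul ℝ ℝ) volume s = conv φ ψ s := by
  rw [convolution_def, conv, intervalIntegral.integral_of_le hs,
    ← integral_indicator measurableSet_Ioc]
  refine integral_congr_ae (Filter.Eventually.of_forall fun t => ?_)
  simp only [mul_apply', indicator]
  split_ifs with ht
  · ring
  · rw [mem_Ioc, not_and_or, not_lt, not_le] at ht
    rcases ht with ht | ht
    · rw [hψ t ht, zero_mul]
    · rw [hφ (s - t) (by linarith), mul_zero]

open ContinuousLinearMap in
/-- On `(0,1)` the convolution is the convolution on the line of the extensions by zero; its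
associativity holds almost everywhere for integrable functions. -/
theorem conv_assoc {u v w : ℝ → ℝ}
    (hu : MemLp u 2 (volume.restrict (Ioo (0 : ℝ) 1)))
    (hv : MemLp v 2 (volume.restrict (Ioo (0 : ℝ) 1)))
    (hw : MemLp w 2 (volume.restrict (Ioo (0 : ℝ) 1))) :
    ∀ᵐ s ∂volume.restrict (Ioo (0 : ℝ) 1), conv (conv u v) w s = conv u (conv v w) s := by
  let E : (ℝ → ℝ) → ℝ → ℝ := fun g => (Ioo (0 : ℝ) 1).indicator g
  have hE0 : ∀ g, ∀ t ≤ 0, E g t = 0 := fun g t ht =>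
    indicator_of_notMem (fun h => absurd h.1 (not_lt.2 ht)) _
  have hEeq : ∀ g, ∀ᵐ t ∂volume.restrict (Ioo (0 : ℝ) 1), g t = E g t := fun g => by
    filter_upwards [ae_restrict_mem measurableSet_Ioo] with t ht
    exact (indicator_of_mem ht g).symm
  have hEi : ∀ g, MemLp g 2 (volume.restrict (Ioo (0 : ℝ) 1)) → Integrable (E g) := fun g hg =>
    (integrable_indicator_iff measurableSet_Ioo).2 (hg.integrable (by norm_num))
  have hc0 : ∀ g g' : ℝ → ℝ, ∀ t ≤ 0, convolution (E g) (E g') (mul ℝ ℝ) volume t = 0 := by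
    intro g g' t ht
    rw [convolution_def]
    refine integral_eq_zero_of_ae (Filter.Eventually.of_forall fun r => ?_)
    simp only [mul_apply', Pi.zero_apply]
    rcases le_or_gt r 0 with hr | hr
    · rw [hE0 g r hr, zero_mul]
    · rw [hE0 g' (t - r) (by linarith), mul_zero]
  have hcE : ∀ g g' : ℝ → ℝ, ∀ t ∈ Ioo (0 : ℝ) 1,
      conv g g' t = convolution (E g') (E g) (mul ℝ ℝ) volume t := fun g g' t ht => by
    rw [conv_congr (hEeq g) (hEeq g') (Ioo_subset_Icc_self ht),
      convolution_eq_conv (hE0 g) (hE0 g') ht.1.le]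
  have hcE' : ∀ g g' : ℝ → ℝ, ∀ᵐ t ∂volume.restrict (Ioo (0 : ℝ) 1),
      conv g g' t = convolution (E g') (E g) (mul ℝ ℝ) volume t := fun g g' => by
    filter_upwards [ae_restrict_mem measurableSet_Ioo] with t ht
    exact hcE g g' t ht
  have hex := (hEi w hw).norm.ae_convolution_exists (mul ℝ ℝ)
    ((hEi v hv).norm.integrable_convolution (mul ℝ ℝ) (hEi u hu).norm)
  filter_upwards [ae_restrict_mem measurableSet_Ioo, ae_restrict_of_ae hex] with s hs hs'
  have hs1 := Ioo_subset_Icc_self hs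
  rw [conv_congr (hcE' u v) (hEeq w) hs1, conv_congr (hEeq u) (hcE' v w) hs1,
    ← convolution_eq_conv (hc0 _ _) (hE0 _) hs.1.le,
    ← convolution_eq_conv (hE0 _) (hc0 _ _) hs.1.le]
  exact (convolution_assoc (mul ℝ ℝ) (mul ℝ ℝ) (mul ℝ ℝ) (mul ℝ ℝ)
    (fun x y z => by simp [mul_assoc]) (hEi w hw).1 (hEi v hv).1 (hEi u hu).1
    ((hEi w hw).ae_convolution_exists _ (hEi v hv))
    ((hEi v hv).norm.ae_convolution_exists _ (hEi u hu).norm) hs').symm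

theorem convL2_assoc {σ : ℝ} (u v w : L2w σ) :
    convL2 (convL2 u v) w = convL2 u (convL2 v w) := by
  refine L2w_ext ?_
  filter_upwards [coeFn_convL2 (convL2 u v) w, coeFn_convL2 u (convL2 v w),
    conv_assoc (memLp_restrict u) (memLp_restrict v) (memLp_restrict w),
    ae_restrict_mem measurableSet_Ioo] with s h1 h2 h3 hs
  have hs1 := Ioo_subset_Icc_self hs
  rw [h1, h2, conv_congr (coeFn_convL2 u v) (Filter.Eventually.of_forall fun _ => rfl) hs1, h3]
  exact (conv_congr (Filter.Eventually.of_forall fun _ => rfl) (coeFn_convL2 v w) hs1).symm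

end Autoconv

/-! ### Volterra equations and the source element -/

namespace Autoconv

theorem memLp_weightedMeasure (σ : ℝ) {u : ℝ → ℝ}
    (hu : MemLp u 2 (volume.restrict (Ioo (0 : ℝ) 1))) : MemLp u 2 (weightedMeasure σ) := by
  refine hu.of_measure_le_smul (c := ENNReal.ofReal (Real.exp (2 * |σ|)))
    ENNReal.ofReal_ne_top ?_
  rw [weightedMeasure, ← withDensity_const]
  refine withDensity_mono ((ae_restrict_iff' measurableSet_Ioo).2
    (Filter.Eventually.of_forall fun t ht => ENNReal.ofReal_le_ofReal (Real.exp_le_exp.2 ?_)))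
  have h1 : -σ * t ≤ |σ| * t := mul_le_mul_of_nonneg_right (neg_le_abs σ) ht.1.le
  have h2 : |σ| * t ≤ |σ| * 1 := mul_le_mul_of_nonneg_left ht.2.le (abs_nonneg σ)
  linarith

theorem exists_L2w_coeFn (σ : ℝ) {u : ℝ → ℝ}
    (hu : MemLp u 2 (volume.restrict (Ioo (0 : ℝ) 1))) :
    ∃ U : L2w σ, ∀ᵐ t ∂volume.restrict (Ioo (0 : ℝ) 1), U t = u t :=
  ⟨(memLp_weightedMeasure σ hu).toLp u,
    ae_weightedMeasure_iff.1 (memLp_weightedMeasure σ hu).coeFn_toLp⟩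

/-- The weighted norm of a fixed function becomes small for a large exponent. -/
theorem exists_integral_exp_mul_lt_one {k : ℝ → ℝ}
    (hk : MemLp k 2 (volume.restrict (Ioo (0 : ℝ) 1))) :
    ∃ τ : ℝ, ∫ t in Ioo (0 : ℝ) 1, Real.exp (-2 * τ * t) * k t ^ 2 < 1 := by
  have h : Filter.Tendsto (fun τ : ℝ => ∫ t in Ioo (0 : ℝ) 1, Real.exp (-2 * τ * t) * k t ^ 2)
      Filter.atTop (nhds (∫ t in Ioo (0 : ℝ) 1, (0 : ℝ))) := by
    refine tendsto_integral_filter_of_dominated_convergence (fun t => k t ^ 2) ?_ ?_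
      hk.integrable_sq ?_
    · exact Filter.Eventually.of_forall fun τ =>
        ((by fun_prop : Measurable fun t : ℝ => Real.exp (-2 * τ * t)).aestronglyMeasurable.mul
          (hk.1.pow 2))
    · filter_upwards [Filter.eventually_ge_atTop 0] with τ hτ
      filter_upwards [ae_restrict_mem measurableSet_Ioo] with t ht
      rw [norm_mul, Real.norm_eq_abs, Real.norm_eq_abs, Real.abs_exp, abs_of_nonneg (sq_nonneg _)]
      refine mul_le_of_le_one_left (sq_nonneg _) (Real.exp_le_one_iff.2 ?_)
      nlinarith [mul_nonneg hτ ht.1.le]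
    · filter_upwards [ae_restrict_mem measurableSet_Ioo] with t ht
      rw [← zero_mul (k t ^ 2)]
      refine Filter.Tendsto.mul_const _ (Real.tendsto_exp_atBot.comp ?_)
      have : (fun τ : ℝ => -2 * τ * t) = fun τ => -(2 * t) * τ := by
        funext τ; ring
      rw [this]
      exact Filter.tendsto_id.const_mul_atTop_of_neg (by linarith [ht.1])
  rw [integral_zero] at h
  exact (h.eventually (gt_mem_nhds one_pos)).exists

/-- The Volterra equation of the second kind `w + k * w = g` is solvable: for a large exponent of
the weight the convolution with `k` is a contraction. -/
theorem exists_add_convL2_eq {σ : ℝ} (k g : L2w σ) : ∃ w : L2w σ, w + convL2 k w = g := by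
  obtain ⟨τ, hτ⟩ := exists_integral_exp_mul_lt_one (memLp_restrict k)
  obtain ⟨K, hK⟩ := exists_L2w_coeFn τ (memLp_restrict k)
  obtain ⟨G, hG⟩ := exists_L2w_coeFn τ (memLp_restrict g)
  have hKn : ‖K‖ < 1 := by
    rw [← sq_lt_one_iff₀ (norm_nonneg _), norm_sq_L2w]
    refine lt_of_eq_of_lt (integral_congr_ae ?_) hτ
    filter_upwards [hK] with t ht
    rw [ht]
  have hc : ContractingWith (Real.toNNReal ‖K‖) fun w : L2w τ => G - convL2 K w := by
    refine ⟨Real.toNNReal_lt_one.2 hKn, LipschitzWith.of_dist_le_mul fun a b => ?_⟩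
    rw [Real.coe_toNNReal _ (norm_nonneg _), dist_comm, dist_eq_norm, dist_comm, dist_eq_norm]
    have e : G - convL2 K b - (G - convL2 K a) = -convL2 K (b - a) := by
      have := map_sub (convBilin τ K) b a
      simp only [convBilin_apply] at this
      rw [this]; abel
    rw [e, norm_neg]
    exact norm_convL2_le _ _
  have hfix : G - convL2 K (hc.fixedPoint _) = hc.fixedPoint _ := hc.fixedPoint_isFixedPt
  set W := hc.fixedPoint _ with hW
  obtain ⟨w, hw⟩ := exists_L2w_coeFn σ (memLp_restrict W)
  refine ⟨w, L2w_ext ?_⟩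
  have hae : ∀ᵐ t ∂volume.restrict (Ioo (0 : ℝ) 1), (G - convL2 K W) t = W t := by
    rw [hfix]
    exact Filter.Eventually.of_forall fun _ => rfl
  filter_upwards [hae, hw, hG, coeFn_convL2 K W, coeFn_convL2 k w,
    ae_weightedMeasure_iff.1 (Lp.coeFn_sub G (convL2 K W)),
    ae_weightedMeasure_iff.1 (Lp.coeFn_add w (convL2 k w)),
    ae_restrict_mem measurableSet_Ioo] with t h1 h2 h3 h4 h5 h6 h7 ht
  have h8 : conv K W t = conv k w t :=
    conv_congr hK (hw.mono fun _ h => h.symm) (Ioo_subset_Icc_self ht)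
  rw [h7, Pi.add_apply, h5, h2, ← h8, ← h1, h6, Pi.sub_apply, h3, h4, sub_add_cancel]

theorem coeFn_constFun (σ a : ℝ) :
    ∀ᵐ t ∂volume.restrict (Ioo (0 : ℝ) 1), constFun σ a t = a :=
  ae_weightedMeasure_iff.1 (Lp.coeFn_const (p := 2) (μ := weightedMeasure σ) a)

theorem coeFn_convL2_one {σ : ℝ} (v : L2w σ) :
    ∀ᵐ t ∂volume.restrict (Ioo (0 : ℝ) 1),
      convL2 (constFun σ 1) v t = ∫ s in (0 : ℝ)..t, v s := by
  filter_upwards [coeFn_convL2 (constFun σ 1) v, ae_restrict_mem measurableSet_Ioo] with t h ht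
  rw [h, conv_congr (coeFn_constFun σ 1) (Filter.Eventually.of_forall fun _ => rfl)
    (Ioo_subset_Icc_self ht)]
  simp [conv]

theorem coeFn_smul_one_add_convL2_one {σ : ℝ} (a : ℝ) (v : L2w σ) :
    ∀ᵐ t ∂volume.restrict (Ioo (0 : ℝ) 1),
      (a • constFun σ 1 + convL2 (constFun σ 1) v) t = a + ∫ s in (0 : ℝ)..t, v s := by
  filter_upwards [coeFn_convL2_one v, coeFn_constFun σ 1,
    ae_weightedMeasure_iff.1 (Lp.coeFn_add (a • constFun σ 1) (convL2 (constFun σ 1) v)),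
    ae_weightedMeasure_iff.1 (Lp.coeFn_smul a (constFun σ 1))] with t h1 h2 h3 h4
  rw [h3, Pi.add_apply, h4, Pi.smul_apply, h1, h2, smul_eq_mul, mul_one]

theorem intervalIntegral_congr_Ioo {u v : ℝ → ℝ}
    (h : ∀ᵐ t ∂volume.restrict (Ioo (0 : ℝ) 1), u t = v t) {t : ℝ} (ht : t ∈ Icc (0 : ℝ) 1) :
    ∫ s in (0 : ℝ)..t, u s = ∫ s in (0 : ℝ)..t, v s := by
  simpa [conv] using conv_congr_right (u := fun _ => 1) h ht

theorem constFun_eq_smul (σ a : ℝ) : constFun σ a = a • constFun σ 1 := by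
  refine L2w_ext ?_
  filter_upwards [coeFn_constFun σ a, coeFn_constFun σ 1,
    ae_weightedMeasure_iff.1 (Lp.coeFn_smul a (constFun σ 1))] with t h1 h2 h3
  rw [h3, Pi.smul_apply, h1, h2, smul_eq_mul, mul_one]

/-- The first-kind equation `F'(x₀) ω = x₀ - x₀(0)` has a solution, which lies in `H₁`.
Differentiating once turns it into the second-kind equation `x₀(0) ω + x₀' * ω = x₀' / 2`; a further
differentiation expresses `ω'` through `x₀''`. -/
theorem exists_source {σ : ℝ} {x₀ : L2w σ} {f : ℝ → ℝ} (hx₀ : SolutionSmoothness x₀ f) :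
    ∃ x₀' ω ω' : L2w σ, HasL2Deriv x₀ x₀' ∧ HasL2Deriv ω ω' ∧
      autoconvDeriv x₀ ω = x₀ - constFun σ (f 0) := by
  obtain ⟨f', f'', hf'', hf', hf⟩ := hx₀.w2inf
  have h0 := hx₀.pos_zero
  obtain ⟨F2, hF2⟩ := exists_L2w_coeFn σ (hf''.mono_exponent (q := ⊤) (p := 2) le_top)
  set e := constFun σ 1 with he
  set F1 := f' 0 • e + convL2 e F2 with hF1
  have hF1ae : ∀ᵐ t ∂volume.restrict (Ioo (0 : ℝ) 1), F1 t = f' t := by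
    filter_upwards [coeFn_smul_one_add_convL2_one (f' 0) F2,
      ae_restrict_mem measurableSet_Ioo] with t h ht
    rw [hF1, h, hf' t (Ioo_subset_Icc_self ht),
      intervalIntegral_congr_Ioo hF2 (Ioo_subset_Icc_self ht)]
  have hx : x₀ = f 0 • e + convL2 e F1 := by
    refine L2w_ext ?_
    filter_upwards [hx₀.repr, coeFn_smul_one_add_convL2_one (f 0) F1,
      ae_restrict_mem measurableSet_Ioo] with t h1 h2 ht
    rw [h1, h2, hf t (Ioo_subset_Icc_self ht),
      intervalIntegral_congr_Ioo hF1ae (Ioo_subset_Icc_self ht)]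
  obtain ⟨ω, hω⟩ := exists_add_convL2_eq ((f 0)⁻¹ • F1) ((2 * f 0)⁻¹ • F1)
  have hω1 : F1 = (2 * f 0) • ω + (2 : ℝ) • convL2 F1 ω := by
    have := congrArg (fun v => (2 * f 0) • v) hω
    simp only [convL2_smul_left, smul_add, smul_smul] at this
    rw [mul_inv_cancel₀ (by positivity), one_smul, mul_assoc, mul_inv_cancel₀ h0.ne',
      mul_one] at this
    exact this.symm
  have hadd : ∀ u v v' : L2w σ, convL2 u (v + v') = convL2 u v + convL2 u v' := fun u v v' =>
    map_add (convBilin σ u) v v'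
  have hsub : ∀ u v v' : L2w σ, convL2 u (v - v') = convL2 u v - convL2 u v' := fun u v v' =>
    map_sub (convBilin σ u) v v'
  have hsmul : ∀ (u : L2w σ) (a : ℝ) (v : L2w σ), convL2 u (a • v) = a • convL2 u v :=
    fun u a v => map_smul (convBilin σ u) a v
  set ω' : L2w σ := (2 * f 0)⁻¹ • F2 - (f' 0 / f 0) • ω - (f 0)⁻¹ • convL2 F2 ω with hω'
  have hωe : ω = (f' 0 / (2 * f 0)) • e + convL2 e ω' := by
    have h1 : ω = (2 * f 0)⁻¹ • F1 - (f 0)⁻¹ • convL2 F1 ω := by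
      rw [eq_sub_iff_add_eq, ← hω, convL2_smul_left]
    have h2 : convL2 F1 ω = f' 0 • convL2 e ω + convL2 e (convL2 F2 ω) := by
      rw [hF1, convL2_add_left, convL2_smul_left, convL2_assoc]
    rw [hω', hsub, hsub, hsmul, hsmul, hsmul]
    conv_lhs => rw [h1, h2, hF1]
    module
  refine ⟨F1, ω, ω', ⟨f 0, ?_⟩, ⟨f' 0 / (2 * f 0), ?_⟩, ?_⟩
  · filter_upwards [coeFn_smul_one_add_convL2_one (f 0) F1] with t ht
    rw [← ht, ← hx]
  · filter_upwards [coeFn_smul_one_add_convL2_one (f' 0 / (2 * f 0)) ω'] with t ht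
    rw [← ht, ← hωe]
  · rw [autoconvDeriv, constFun_eq_smul, ← he]
    conv_lhs => rw [hx]
    conv_rhs => rw [hx]
    rw [convL2_add_left, convL2_smul_left, convL2_assoc, add_sub_cancel_left]
    conv_rhs => rw [hω1, hadd, hsmul, hsmul]
    module

end Autoconv

/-! ### The reference value -/

namespace Autoconv

theorem IsW2Inf.exists_abs_sub_le {f : ℝ → ℝ} (hf : IsW2Inf f) :
    ∃ M : ℝ, 0 ≤ M ∧ ∀ t ∈ Icc (0 : ℝ) 1, |f t - f 0| ≤ M * t := by
  obtain ⟨f', f'', hf'', hf', hf⟩ := hf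
  have hint : IntegrableOn f'' (Ioo (0 : ℝ) 1) := hf''.integrable le_top
  have hb : ∀ t ∈ Icc (0 : ℝ) 1, |f' t| ≤ |f' 0| + ∫ s in Ioo (0 : ℝ) 1, |f'' s| := by
    intro t ht
    rw [hf' t ht]
    refine (abs_add_le _ _).trans (add_le_add_right ?_ _)
    rw [intervalIntegral.integral_of_le ht.1, integral_Ioc_eq_integral_Ioo]
    rw [← Real.norm_eq_abs]
    refine (norm_integral_le_integral_norm _).trans ?_
    exact setIntegral_mono_set hint.norm (Filter.Eventually.of_forall fun _ => norm_nonneg _)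
      (Filter.Eventually.of_forall (Ioo_subset_Ioo_right ht.2))
  refine ⟨|f' 0| + ∫ s in Ioo (0 : ℝ) 1, |f'' s|, ?_, fun t ht => ?_⟩
  · exact add_nonneg (abs_nonneg _) (integral_nonneg fun _ => abs_nonneg _)
  · rw [hf t ht, add_sub_cancel_left]
    have := intervalIntegral.norm_integral_le_of_norm_le_const (a := 0) (b := t) (f := f')
      (C := |f' 0| + ∫ s in Ioo (0 : ℝ) 1, |f'' s|) fun s hs => by
        rw [uIoc_of_le ht.1] at hs
        exact hb s ⟨hs.1.le, hs.2.trans ht.2⟩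
    rwa [sub_zero, abs_of_nonneg ht.1] at this

theorem SolutionSmoothness.exists_abs_conv_sub_le {σ : ℝ} {x₀ : L2w σ} {f : ℝ → ℝ}
    (hx₀ : SolutionSmoothness x₀ f) :
    ∃ K : ℝ, 0 ≤ K ∧ ∀ s ∈ Icc (0 : ℝ) 1, |conv f f s - s * f 0 ^ 2| ≤ K * s ^ 2 := by
  obtain ⟨M, hM, hf⟩ := hx₀.w2inf.exists_abs_sub_le
  have h0 := hx₀.pos_zero
  have hmem : MemLp f 2 (volume.restrict (Ioo (0 : ℝ) 1)) :=
    (memLp_congr_ae hx₀.repr).1 (memLp_restrict x₀)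
  refine ⟨(f 0 + M) * M + f 0 * M, by positivity, fun s hs => ?_⟩
  have e : conv f f s - s * f 0 ^ 2 = ∫ t in (0 : ℝ)..s, (f (s - t) * f t - f 0 ^ 2) := by
    rw [intervalIntegral.integral_sub (intervalIntegrable_conv hmem hmem hs)
      intervalIntegrable_const, intervalIntegral.integral_const, conv]
    simp
  rw [e]
  have := intervalIntegral.norm_integral_le_of_norm_le_const (a := 0) (b := s)
    (f := fun t => f (s - t) * f t - f 0 ^ 2)
    (C := ((f 0 + M) * M + f 0 * M) * s) fun t ht => by
      rw [uIoc_of_le hs.1] at ht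
      have h1 := hf t ⟨ht.1.le, ht.2.trans hs.2⟩
      have h2 := hf (s - t) ⟨by linarith [ht.2], by linarith [ht.1, hs.2]⟩
      have h3 : |f (s - t)| ≤ f 0 + M := by
        have := abs_le.1 h2
        rw [abs_le]
        constructor <;> nlinarith [ht.1, ht.2, hs.2]
      have e : f (s - t) * f t - f 0 ^ 2 = f (s - t) * (f t - f 0) + f 0 * (f (s - t) - f 0) := by
        ring
      rw [e]
      refine (norm_add_le _ _).trans ?_
      rw [norm_mul, norm_mul, Real.norm_eq_abs, Real.norm_eq_abs, Real.norm_eq_abs,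
        Real.norm_eq_abs, abs_of_pos h0]
      have h4 : |f t - f 0| ≤ M * s := h1.trans (by gcongr; exact ht.2)
      have h5 : |f (s - t) - f 0| ≤ M * s := h2.trans (by gcongr; linarith [ht.1])
      calc |f (s - t)| * |f t - f 0| + f 0 * |f (s - t) - f 0|
          ≤ (f 0 + M) * (M * s) + f 0 * (M * s) := by gcongr
        _ = _ := by ring
  rw [sub_zero, abs_of_nonneg hs.1, mul_assoc, ← sq] at this
  exact this

theorem exists_nat_partition {m : ℕ} (hm : 1 ≤ m) {s : ℝ} (hs : s ∈ Icc (0 : ℝ) 1) :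
    ((min ⌊(m : ℝ) * s⌋₊ (m - 1) : ℕ) : ℝ) / m ≤ s ∧
      s ≤ (((min ⌊(m : ℝ) * s⌋₊ (m - 1) : ℕ) : ℝ) + 1) / m ∧
      (((min ⌊(m : ℝ) * s⌋₊ (m - 1) : ℕ) : ℝ) + 1) / m ≤ 1 := by
  have hm0 : (0 : ℝ) < m := by exact_mod_cast hm
  have hfl := Nat.floor_le (mul_nonneg hm0.le hs.1)
  have hlt := Nat.lt_floor_add_one ((m : ℝ) * s)
  have hsub : ((m - 1 : ℕ) : ℝ) = m - 1 := by push_cast [hm]; ring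
  refine ⟨?_, ?_, ?_⟩
  · rw [div_le_iff₀ hm0]
    have : ((min ⌊(m : ℝ) * s⌋₊ (m - 1) : ℕ) : ℝ) ≤ (⌊(m : ℝ) * s⌋₊ : ℝ) := by
      exact_mod_cast min_le_left _ _
    linarith
  · rw [le_div_iff₀ hm0, Nat.cast_min, hsub]
    rcases min_choice (⌊(m : ℝ) * s⌋₊ : ℝ) ((m : ℝ) - 1) with h | h <;> rw [h]
    · linarith
    · nlinarith [hs.2]
  · rw [div_le_one hm0]
    have : ((min ⌊(m : ℝ) * s⌋₊ (m - 1) : ℕ) : ℝ) ≤ ((m - 1 : ℕ) : ℝ) := by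
      exact_mod_cast min_le_right _ _
    linarith

/-- Averaging over an interval within distance `1 / m` of `s` recovers `b` up to the oscillation of
`y` around `b` there. -/
theorem abs_pwConstProj_sub_le {m : ℕ} (hm : 1 ≤ m) {y : ℝ → ℝ}
    (hy : MemLp y 2 (volume.restrict (Ioo (0 : ℝ) 1))) {s b D : ℝ} (hs : s ∈ Icc (0 : ℝ) 1)
    (h : ∀ᵐ t ∂volume.restrict (Ioo (0 : ℝ) 1), |t - s| ≤ 1 / m → |y t - b| ≤ D) :
    |pwConstProj m y s - b| ≤ D := by
  have hm0 : (0 : ℝ) < m := by exact_mod_cast hm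
  obtain ⟨h1, h2, h3⟩ := exists_nat_partition hm hs
  rw [pwConstProj]
  set i : ℕ := min ⌊(m : ℝ) * s⌋₊ (m - 1)
  have h0 : (0 : ℝ) ≤ (i : ℝ) / m := by positivity
  have hlen : ((i : ℝ) + 1) / m - (i : ℝ) / m = 1 / m := by ring
  have hle : (i : ℝ) / m ≤ ((i : ℝ) + 1) / m := by
    have : (0 : ℝ) < 1 / m := by positivity
    linarith
  have hyi : IntervalIntegrable y volume ((i : ℝ) / m) (((i : ℝ) + 1) / m) :=
    (intervalIntegrable_iff_integrableOn_Ioo_of_le hle).2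
      (IntegrableOn.mono_set (hy.integrable (by norm_num))
        (Ioo_subset_Ioo h0 h3))
  have e : (m : ℝ) * (∫ t in ((i : ℝ) / m)..(((i : ℝ) + 1) / m), y t) - b =
      m * ∫ t in ((i : ℝ) / m)..(((i : ℝ) + 1) / m), (y t - b) := by
    rw [intervalIntegral.integral_sub hyi intervalIntegrable_const,
      intervalIntegral.integral_const, hlen, smul_eq_mul]
    field_simp
  change |(m : ℝ) * (∫ t in ((i : ℝ) / m)..(((i : ℝ) + 1) / m), y t) - b| ≤ D
  rw [e, abs_mul, abs_of_pos hm0]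
  have h4 : ‖∫ t in ((i : ℝ) / m)..(((i : ℝ) + 1) / m), (y t - b)‖ ≤
      D * |((i : ℝ) + 1) / m - (i : ℝ) / m| := by
    refine intervalIntegral.norm_integral_le_of_norm_le_const_ae ?_
    have h' := (ae_restrict_iff' measurableSet_Ioo).1 h
    filter_upwards [h', Measure.ae_ne volume (1 : ℝ)] with t ht ht1 hti
    rw [uIoc_of_le hle] at hti
    refine ht ⟨h0.trans_lt hti.1, lt_of_le_of_ne (hti.2.trans h3) ht1⟩ ?_
    rw [abs_le]
    constructor <;> linarith [hti.1, hti.2]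
  rw [hlen, abs_of_pos (by positivity : (0 : ℝ) < 1 / m), Real.norm_eq_abs] at h4
  calc (m : ℝ) * |∫ t in ((i : ℝ) / m)..(((i : ℝ) + 1) / m), (y t - b)|
      ≤ m * (D * (1 / m)) := by gcongr
    _ = D := by field_simp

theorem abs_sqrt_sub_le {A b D : ℝ} (hb : 0 < b) (h : |A - b ^ 2| ≤ D) :
    |Real.sqrt A - b| ≤ D / b := by
  rw [le_div_iff₀ hb]
  refine le_trans ?_ h
  rcases le_or_gt 0 A with hA | hA
  · have e : A - b ^ 2 = (Real.sqrt A - b) * (Real.sqrt A + b) := by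
      nlinarith [Real.sq_sqrt hA]
    rw [e, abs_mul]
    gcongr
    rw [abs_of_nonneg (by positivity)]
    linarith [Real.sqrt_nonneg A]
  · rw [Real.sqrt_eq_zero_of_nonpos hA.le, zero_sub, abs_neg, abs_of_pos hb,
      abs_of_neg (by nlinarith)]
    nlinarith

/-- The reference value recovers `x₀(0)` with accuracy `O(√δ)`: by `F(x₀)(s) = s x₀(0)² + O(s²)` the
mean of the data near `s = √δ` equals `√δ x₀(0)² + O(δ)`. -/
theorem exists_abs_refValue_sub_le {σ : ℝ} (hσ : 0 < σ) {x₀ : L2w σ} {f : ℝ → ℝ}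
    (hx₀ : SolutionSmoothness x₀ f) :
    ∃ κ : ℝ, 0 ≤ κ ∧ ∀ δ : ℝ, 0 < δ → δ ≤ 1 → ∀ m : ℕ, σ / δ ≤ m → ∀ y : L2w σ,
      (∀ᵐ t ∂volume.restrict (Ioo (0 : ℝ) 1), |y t - autoconv x₀ t| ≤ δ) →
      |refValue m δ y - f 0| ≤ κ * Real.sqrt δ := by
  obtain ⟨K, hK, hconv⟩ := hx₀.exists_abs_conv_sub_le
  have h0 := hx₀.pos_zero
  refine ⟨(1 + K * (1 + 1 / σ) ^ 2 + 1 / σ * f 0 ^ 2) / f 0, by positivity,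
    fun δ hδ hδ1 m hm y hy => ?_⟩
  set s := Real.sqrt δ with hs
  have hs0 : 0 < s := Real.sqrt_pos.2 hδ
  have hs2 : s ^ 2 = δ := Real.sq_sqrt hδ.le
  have hs1 : s ≤ 1 := by
    exact Real.sqrt_le_iff.2 ⟨zero_le_one, by rwa [one_pow]⟩
  have hm0 : (0 : ℝ) < m := lt_of_lt_of_le (by positivity) hm
  have hm1 : 1 ≤ m := by exact_mod_cast hm0
  have hmδ : 1 / (m : ℝ) ≤ 1 / σ * s ^ 2 := by
    rw [hs2, div_le_iff₀ hm0]
    calc (1 : ℝ) = 1 / σ * δ * (σ / δ) := by field_simp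
      _ ≤ 1 / σ * δ * m := by gcongr
  have hmean : |pwConstProj m y s - s * f 0 ^ 2| ≤
      (1 + K * (1 + 1 / σ) ^ 2 + 1 / σ * f 0 ^ 2) * s ^ 2 := by
    refine abs_pwConstProj_sub_le hm1 (memLp_restrict y) ⟨hs0.le, hs1⟩ ?_
    filter_upwards [hy, coeFn_convL2 x₀ x₀, ae_restrict_mem measurableSet_Ioo] with t h1 h2 ht hts
    have ht' := Ioo_subset_Icc_self ht
    have h3 : autoconv x₀ t = conv f f t := by
      rw [autoconv, h2, conv_congr hx₀.repr hx₀.repr ht']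
    rw [h3, ← hs2] at h1
    have h4 := hconv t ht'
    have h5 : |t - s| ≤ 1 / σ * s ^ 2 := hts.trans hmδ
    have h6 : t ≤ (1 + 1 / σ) * s := by
      have : 1 / σ * s ^ 2 ≤ 1 / σ * s := by
        gcongr
        nlinarith
      linarith [(abs_le.1 h5).2]
    have h7 : K * t ^ 2 ≤ K * ((1 + 1 / σ) * s) ^ 2 := by
      gcongr
      exact ht.1.le
    have h8 : |t * f 0 ^ 2 - s * f 0 ^ 2| ≤ 1 / σ * s ^ 2 * f 0 ^ 2 := by
      rw [← sub_mul, abs_mul, abs_of_nonneg (sq_nonneg (f 0))]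
      gcongr
    calc |y t - s * f 0 ^ 2| = |(y t - conv f f t) + (conv f f t - t * f 0 ^ 2) +
          (t * f 0 ^ 2 - s * f 0 ^ 2)| := by congr 1; ring
      _ ≤ s ^ 2 + K * t ^ 2 + 1 / σ * s ^ 2 * f 0 ^ 2 :=
          (abs_add_three _ _ _).trans (by gcongr)
      _ ≤ s ^ 2 + K * ((1 + 1 / σ) * s) ^ 2 + 1 / σ * s ^ 2 * f 0 ^ 2 := by gcongr
      _ = _ := by ring
  -- for a negative mean the real square root is `0`, in line with the definition of `refValue`
  have href : refValue m δ y = Real.sqrt (1 / s * pwConstProj m y s) := by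
    rw [refValue]
    split_ifs with h
    · rfl
    · rw [Real.sqrt_eq_zero_of_nonpos]
      exact mul_nonpos_of_nonneg_of_nonpos (by positivity) (not_le.1 h).le
  rw [href, div_mul_eq_mul_div (_ + _)]
  refine abs_sqrt_sub_le h0 ?_
  have e : 1 / s * pwConstProj m y s - f 0 ^ 2 = (pwConstProj m y s - s * f 0 ^ 2) / s := by
    field_simp
  rw [e, abs_div, abs_of_pos hs0, div_le_iff₀ hs0]
  linarith

end Autoconv

/-! ### Convergence rate -/

namespace Autoconv

theorem l2norm_le {σ : ℝ} (hσ : 0 ≤ σ) (u : L2w σ) : l2norm u ≤ Real.exp σ * ‖u‖ := by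
  rw [l2norm]
  refine Real.sqrt_le_iff.2 ⟨by positivity, ?_⟩
  rw [mul_pow, norm_sq_L2w, ← integral_const_mul]
  have hle : ∀ t ∈ Ioo (0 : ℝ) 1, 1 ≤ Real.exp σ ^ 2 * Real.exp (-2 * σ * t) ∧
      Real.exp (-2 * σ * t) ≤ 1 := fun t ht => by
    rw [← Real.exp_nat_mul, ← Real.exp_add]
    refine ⟨Real.one_le_exp ?_, Real.exp_le_one_iff.2 ?_⟩
    · push_cast
      nlinarith [ht.2]
    · nlinarith [mul_nonneg hσ ht.1.le]
  have hsq := (memLp_restrict u).integrable_sq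
  refine integral_mono_of_nonneg (Filter.Eventually.of_forall fun t => sq_nonneg _) ?_ ?_
  · refine ((hsq.mono ((by fun_prop : Measurable fun t : ℝ =>
      Real.exp (-2 * σ * t)).aestronglyMeasurable.mul hsq.1) ?_)).const_mul _
    filter_upwards [ae_restrict_mem measurableSet_Ioo] with t ht
    rw [Pi.mul_apply, norm_mul, Real.norm_eq_abs (Real.exp _), Real.abs_exp]
    exact mul_le_of_le_one_left (norm_nonneg _) (hle t ht).2
  · filter_upwards [ae_restrict_mem measurableSet_Ioo] with t ht
    rw [← mul_assoc]
    exact le_mul_of_one_le_left (sq_nonneg _) (hle t ht).1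

theorem ApproximationPower.norm_sub_starProjection_le {σ L : ℝ} (hσ : 0 < σ)
    {X : ℕ → Submodule ℝ (L2w σ)} [∀ m, FiniteDimensional ℝ (X m)] (hX : ApproximationPower X L)
    {δ : ℝ} (hδ : 0 < δ) {m : ℕ} (hm : σ / δ ≤ m) {x x' : L2w σ} (hx : HasL2Deriv x x') :
    ‖x - (X m).starProjection x‖ ≤ |L| / σ * h1norm x x' * δ := by
  have hm0 : (0 : ℝ) < m := lt_of_lt_of_le (by positivity) hm
  have hh : 0 ≤ h1norm x x' := by
    rw [h1norm]
    positivity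
  rw [Submodule.starProjection_minimal]
  refine (hX.approx m (by exact_mod_cast hm0) x x' hx).trans ?_
  have h1 : L / m ≤ |L| / σ * δ := by
    rw [div_le_iff₀ hm0]
    calc L ≤ |L| := le_abs_self L
      _ = |L| / σ * δ * (σ / δ) := by field_simp
      _ ≤ |L| / σ * δ * m := by gcongr
  calc L / m * h1norm x x' ≤ |L| / σ * δ * h1norm x x' := by gcongr
    _ = _ := by ring

theorem norm_constFun_sub_le {σ : ℝ} (hσ : 0 ≤ σ) (a b : ℝ) :
    ‖constFun σ a - constFun σ b‖ ≤ |a - b| := by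
  refine norm_le_of_abs_le hσ (abs_nonneg _) ?_
  filter_upwards [coeFn_constFun σ a, coeFn_constFun σ b,
    ae_weightedMeasure_iff.1 (Lp.coeFn_sub (constFun σ a) (constFun σ b))] with t h1 h2 h3
  rw [h3, Pi.sub_apply, h1, h2]

end Autoconv

open Autoconv in
theorem theorem2 (σ : ℝ) (hσ : 0 < σ) (x₀ : L2w σ) (f : ℝ → ℝ)
    (hx₀ : SolutionSmoothness x₀ f)
    (haccretive : ∀ v : L2w σ, 0 ≤ inner ℝ (autoconvDeriv x₀ v) v)
    (hω : ∀ ω : L2w σ, autoconvDeriv x₀ ω = x₀ - constFun σ (f 0) → ‖ω‖ < 1 / 4)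
    (L : ℝ) :
    ∃ c : ℝ, 0 < c ∧ ∃ C : ℝ, 0 < C ∧
      ∀ (X : ℕ → Submodule ℝ (L2w σ)) [∀ m, FiniteDimensional ℝ (X m)],
        ApproximationPower X L →
        ∀ δ : ℝ, 0 < δ → δ ≤ 1 → ∀ m : ℕ, σ / δ ≤ m →
        ∀ y : L2w σ,
          (∀ᵐ t ∂(MeasureTheory.volume.restrict (Set.Ioo (0 : ℝ) 1)),
            |y t - autoconv x₀ t| ≤ δ) →
          ∃ x ∈ X m,
            SolvesLavrentiev (X m) (c * Real.sqrt δ) (constFun σ (refValue m δ y)) y x ∧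
            ‖x₀ - x‖ ≤ c * Real.sqrt δ ∧
            l2norm (x₀ - x) ≤ C * Real.sqrt δ := by
  obtain ⟨x₀', ω, ω', hx', hω', hsrc⟩ := exists_source hx₀
  obtain ⟨κ, hκ0, hκ⟩ := exists_abs_refValue_sub_le hσ hx₀
  have hω4 := hω ω hsrc
  set ε := 1 / 4 - ‖ω‖ with hε
  have hε0 : 0 < ε := by linarith
  have hε4 : ε ≤ 1 / 4 := by linarith [norm_nonneg ω]
  set C₁ := |L| / σ * h1norm x₀ x₀' with hC₁
  set C₂ := |L| / σ * h1norm ω ω' with hC₂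
  have hC₁0 : 0 ≤ C₁ := by
    rw [hC₁, h1norm]
    positivity
  have hC₂0 : 0 ≤ C₂ := by
    rw [hC₂, h1norm]
    positivity
  set N := ‖x₀‖
  have hN : 0 ≤ N := norm_nonneg _
  -- `c` is so large that all discretization and data errors are at most `ε / 4` relative to `α`
  set S := κ + 2 * N * C₂ + 1 + 2 * N * C₁ + C₁ with hS
  have hS0 : 0 ≤ S := by positivity
  set c := 1 + S / (ε / 4) with hc
  have hc1 : 1 ≤ c := by
    have : 0 ≤ S / (ε / 4) := by positivity
    linarith
  have hcS : S ≤ c * (ε / 4) := by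
    rw [hc, add_mul, div_mul_cancel₀ _ (by positivity)]
    linarith
  refine ⟨c, by linarith, Real.exp σ * c, by positivity, ?_⟩
  intro X _ hX δ hδ hδ1 m hm y hy
  set s := Real.sqrt δ with hs
  have hs0 : 0 < s := Real.sqrt_pos.2 hδ
  have hs2 : s ^ 2 = δ := Real.sq_sqrt hδ.le
  have hs1 : s ≤ 1 := by
    exact Real.sqrt_le_iff.2 ⟨zero_le_one, by rwa [one_pow]⟩
  have hp := hX.norm_sub_starProjection_le hσ hδ hm hx'
  have hq := hX.norm_sub_starProjection_le hσ hδ hm hω'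
  rw [← hC₁, ← hs2] at hp
  rw [← hC₂, ← hs2] at hq
  have hz : ‖constFun σ (refValue m δ y) - constFun σ (f 0)‖ ≤ κ * s :=
    (norm_constFun_sub_le hσ.le _ _).trans (hκ δ hδ hδ1 m hm y hy)
  have hyn : ‖y - convBilin σ x₀ x₀‖ ≤ s ^ 2 := by
    rw [hs2]
    refine norm_le_of_abs_le hσ.le hδ.le ?_
    filter_upwards [hy, ae_weightedMeasure_iff.1 (Lp.coeFn_sub y (convBilin σ x₀ x₀))] with t h1 h2
    rw [h2]
    exact h1
  have hss : s ^ 2 ≤ s := pow_le_of_le_one hs0.le hs1 two_ne_zero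
  have hp' : ‖x₀ - (X m).starProjection x₀‖ ≤ c * s * (ε / 4) := by
    refine hp.trans ?_
    calc C₁ * s ^ 2 ≤ S * s := by
          gcongr
          rw [hS]
          have : 0 ≤ κ + 2 * N * C₂ + 1 + 2 * N * C₁ := by positivity
          linarith
      _ ≤ c * (ε / 4) * s := by gcongr
      _ = c * s * (ε / 4) := by ring
  have hg : c * s * ‖constFun σ (refValue m δ y) - constFun σ (f 0)‖ +
      ‖y - convBilin σ x₀ x₀‖ + 2 * N * (‖x₀ - (X m).starProjection x₀‖ +
        c * s * ‖ω - (X m).starProjection ω‖) ≤ (c * s) ^ 2 * (ε / 4) := by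
    calc _ ≤ c * s * (κ * s) + s ^ 2 + 2 * N * (C₁ * s ^ 2 + c * s * (C₂ * s ^ 2)) := by
          gcongr
      _ ≤ c * s * (κ * s) + c * s ^ 2 + 2 * N * (c * (C₁ * s ^ 2) + c * s * (C₂ * s)) :=
          add_le_add (add_le_add le_rfl (le_mul_of_one_le_left (by positivity) hc1))
            (mul_le_mul_of_nonneg_left (add_le_add (le_mul_of_one_le_left (by positivity) hc1)
              (by gcongr)) (by positivity))
      _ = c * s ^ 2 * (κ + 2 * N * C₂ + 1 + 2 * N * C₁) := by ring
      _ ≤ c * s ^ 2 * (c * (ε / 4)) := by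
          gcongr
          linarith
      _ = _ := by ring
  have hr : ‖ω‖ + ε / 4 + (1 / 2 - ε + ε / 4) ^ 2 ≤ 1 / 2 - ε := by
    have h1 : ε * ε ≤ ε * (1 / 4) := mul_le_mul_of_nonneg_left hε4 hε0.le
    have h2 : ‖ω‖ = 1 / 4 - ε := by linarith
    rw [h2]
    linarith
  obtain ⟨x, hxm, hsol, hxn⟩ := exists_galerkin_solution (X m) (convBilin σ)
    (fun u v => norm_convL2_le u v) (fun u v => convL2_comm u v) x₀ haccretive ω
    (constFun σ (f 0)) (constFun σ (refValue m δ y)) y hsrc (α := c * s) (η := ε / 4)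
    -- `r = 1 / 2 - ε` gives `r - r² = 1 / 4 - ε²`, which exceeds `‖ω‖ = 1 / 4 - ε` by
    -- `ε - ε² ≥ 3 ε / 4`
    (r := 1 / 2 - ε) (by positivity) (by linarith) hp' hg hr (by linarith)
  refine ⟨x, hxm, hsol, hxn, (l2norm_le hσ.le _).trans ?_⟩
  rw [mul_assoc]
  gcongr
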